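/- **Stability condition of the relay queue.** Consider $N$ symmetric user equipments (UEs), a relay $R$ and an access point (mmAP), in slotted time. In each slot every UE independently transmits a packet with probability $$q_{tx}=\frac{q_u}{1+D_a q_u\bigl(1-(q_{uf}q_{um})^2-(q_{uf}q_{ur})^2-q_{ub}^2\bigr)},$$ where $q_u\in[0,1]$ is the UE transmit probability and $D_a\in\mathbb N$ the beam alignment duration. A transmitting UE uses a fully directional (FD) transmission with probability $q_{uf}$ and a broadcast to $R$ and mmAP with probability $q_{ub}=1-q_{uf}$; an FD transmission is directed to $R$ with probability $q_{ur}$ and to the mmAP with probability $q_{um}=1-q_{ur}$. If its queue is not empty, $R$ transmits the head-of-line packet to the mmAP with probability $q_r\in[0,1]$. Given who transmits and how, all receptions are independent, with arbitrary success probabilities in $[0,1]$: * $P^{f}_{ur}(j,l)$ and $P^{b}_{ur}(j,l)$ for the reception at $R$ of an FD, resp. broadcast, packet, where $j$ other UEs send FD to $R$ and $l$ other UEs broadcast; * $P^{b}_{ud}(i,\rho,l)$ for the reception at the mmAP of a broadcast packet, where $i$ other UEs send FD to the mmAP, $l$ other UEs broadcast, and $R$ transmits iff $\rho=1$; * $P^{f}_{rd}(i,l)$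 for the reception at the mmAP of a packet of $R$, where $i$ UEs send FD to the mmAP and $l$ UEs broadcast. A packet enters the infinite queue of $R$ if it is sent FD to $R$ and received there, or if it is broadcast, received by $R$ and not received by the mmAP; a packet leaves the queue when the mmAP receives it from $R$. The queue is called stable if the Markov chain of queue lengths is positive recurrent in the following sense: from every initial length the mean time until the queue is (next) empty is finite. Write $\bar x=1-x$ and, for $\rho\in\{0,1\}$, $P_1=P^{f}_{ur}(j-1,m-i)$, $P_2=P^{b}_{ur}(j,m-i-1)\,\overline{P}^{b}_{ud}(i-j,\rho,m-i-1)$, and $$r_k(\rho)=\sum_{m=k}^{N}\binom Nm q_{tx}^m\bar q_{tx}^{N-m}\sum_{i=0}^m\binom mi q_{uf}^iq_{ub}^{m-i}\sum_{j=\max(0,k+i-m)}^{i}\binom ij q_{ur}^jq_{um}^{i-j}\sum_{k_f=\max(0,k+i-m)}^{\min(j,k)}\binom j{k_f}P_1^{k_f}\bar P_1^{\,j-k_f}\binom{m-i}{k-k_f}P_2^{k-k_f}\bar P_2^{\,m-i-k+k_f}.$$ (Factors $P_1$, $P_2$ with $j=0$, resp. $m=i$, occur only with exponent $0$.) Let $$\lambda_r^0=\sum_{k=1}^N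 k\,r_k(0),\qquad A_r=\sum_{k=1}^N k\,r_k(1),$$ $$B_r=\sum_{m=0}^{N}\binom Nm q_{tx}^m\bar q_{tx}^{N-m}\sum_{i=0}^m\binom mi q_{uf}^iq_{ub}^{m-i}\sum_{j=0}^{i}\binom ij q_{ur}^jq_{um}^{i-j}P^{f}_{rd}(i-j,m-i),$$ $\lambda_r^1=\bar q_r\lambda_r^0+q_rA_r$, $\mu_r=q_rB_r$. Then: 1. The queue is stable if and only if $\lambda_r^1<\mu_r$. 2. If $\lambda_r^0+B_r-A_r>0$, the queue is stable if and only if $q_{r\min}<q_r\le 1$, where $q_{r\min}=\dfrac{\lambda_r^0}{\lambda_r^0+B_r-A_r}$. 3. If $\lambda_r^0+B_r-A_r\le 0$, the queue is not stable for any $q_r\in[0,1]$. 4. For $N=2$, with $\overline{P}_{ud}(i,l):=\overline{P}^{b}_{ud}(i,\rho,l)$, the numbers $\lambda_r^0$ (case $\rho=0$) and $A_r$ (case $\rho=1$) equal $$\begin{aligned}&2q_{tx}\bar q_{tx}q_{uf}q_{ur}P^f_{ur}(0,0)+2q_{tx}\bar q_{tx}q_{ub}P^b_{ur}(0,0)\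overline{P}_{ud}(0,0)\\&+q_{tx}^2q_{uf}^2q_{ur}^2\bigl[2P^f_{ur}(1,0)\overline{P}^f_{ur}(1,0)+2P^f_{ur}(1,0)^2\bigr]+2q_{tx}^2q_{uf}^2q_{ur}q_{um}P^f_{ur}(0,0)\\&+2q_{tx}^2q_{uf}q_{ub}q_{ur}\bigl[P^f_{ur}(0,1)\bigl(1-P^b_{ur}(1,0)\overline{P}_{ud}(0,0)\bigr)+\overline{P}^f_{ur}(0,1)P^b_{ur}(1,0)\overline{P}_{ud}(0,0)+2P^f_{ur}(0,1)P^b_{ur}(1,0)\overline{P}_{ud}(0,0)\bigr]\\&+2q_{tx}^2q_{ub}q_{uf}q_{um}P^b_{ur}(0,0)\overline{P}_{ud}(1,0)\\&+q_{tx}^2q_{ub}^2\bigl[2P^b_{ur}(0,1)\overline{P}_{ud}(0,1)\bigl(1-P^b_{ur}(0,1)\overline{P}_{ud}(0,1)\bigr)+2\bigl(P^b_{ur}(0,1)\overline{P}_{ud}(0,1)\bigr)^2\bigr],\end{aligned}$$ and $$\begin{aligned}B_r={}&P^f_{rd}(0,0)\bigl(\bar q_{tx}^2+2q_{tx}\bar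 q_{tx}q_{uf}q_{ur}+q_{tx}^2q_{uf}^2q_{ur}^2\bigr)+P^f_{rd}(1,0)\bigl(2q_{tx}\bar q_{tx}q_{uf}q_{um}+2q_{tx}^2q_{uf}^2q_{um}q_{ur}\bigr)\\&+P^f_{rd}(0,1)\bigl(2q_{tx}\bar q_{tx}q_{ub}+2q_{tx}^2q_{ub}q_{uf}q_{ur}\bigr)+P^f_{rd}(2,0)\,q_{tx}^2q_{uf}^2q_{um}^2\\&+2P^f_{rd}(1,1)\,q_{tx}^2q_{uf}q_{ub}q_{um}+P^f_{rd}(0,2)\,q_{tx}^2q_{ub}^2.\end{aligned}$$ -/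

import Mathlib

open MeasureTheory Finset
open scoped unitInterval ENNReal

/-- The three transmission strategies of a user equipment (UE): fully directional to the access
point (`fm`), fully directional to the relay (`fr`), broadcast to both (`b`). -/
inductive Strategy where
  | fm
  | fr
  | b
  deriving DecidableEq

/-- The parameters of the relay-assisted network, except for the relay transmit probability.
The success probabilities are arbitrary numbers in `[0,1]`, indexed by the interferers they depend
on: fully directional transmissions to the access point (the mmAP) do not disturb the relay and
vice versa, broadcast transmissions disturb both, and the relay does not disturb itself. -/
structure RelayNetwork where
  /-- number of UEs -/
  N : ℕ
  /-- duration of a beam alignment, in timeslots -/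
  Da : ℕ
  /-- UE transmit probability -/
  qu : I
  /-- probability that a UE uses a fully directional transmission -/
  quf : I
  /-- probability that a fully directional transmission is directed to the relay -/
  qur : I
  /-- `Purf j l`: success of a directional UE-relay transmission, with `j` interfering UEs that
  transmit directionally to the relay and `l` that broadcast -/
  Purf : ℕ → ℕ → I
  /-- `Purb j l`: success at the relay of a broadcast transmission, same interferers -/
  Purb : ℕ → ℕ → I
  /-- `Pudb i r l`: success at the mmAP of a broadcast transmission, with `i` interfering UEs that
  transmit directionally to the mmAP, the relay interfering iff `r`, `l` that broadcast -/
  Pudb : ℕ → Bool → ℕ → I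
  /-- `Prdf i l`: success of a relay-mmAP transmission, with `i` interfering UEs that transmit
  directionally to the mmAP and `l` that broadcast -/
  Prdf : ℕ → ℕ → I

namespace RelayNetwork

noncomputable section

variable (net : RelayNetwork)

/-- probability of a broadcast transmission -/
def qub : ℝ := 1 - net.quf

/-- probability that a fully directional transmission is directed to the mmAP -/
def qum : ℝ := 1 - net.qur

/-- Actual UE transmit probability, `q_u` times the probability of not being in an alignment. -/
def qtx : ℝ :=
  net.qu / (1 + net.Da * net.qu *
    (1 - (net.quf * net.qum) ^ 2 - ((net.quf : ℝ) * net.qur) ^ 2 - net.qub ^ 2))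

/-! ### The relay queue as a stochastic process -/

/-- The randomness of one timeslot, a family of independent uniform variables in `[0,1]`:
for each UE three that decide its action (transmit or not, scheme, target) and two that decide
the reception of its packet (at the relay, at the mmAP); for the relay one that decides whether it
wants to transmit and one that decides the reception at the mmAP.
An event of probability `p` is realized as `u < p`. -/
abbrev SlotNoise : Type := (Fin net.N → I × I × I) × (Fin net.N → I × I) × (I × I)

/-- Action of a UE: `none` if it does not transmit, otherwise the strategy it uses. -/
def action (u : I × I × I) : Option Strategy :=
  if (u.1 : ℝ) < net.qtx then
    some (if u.2.1 < net.quf then (if u.2.2 < net.qur then Strategy.fr else Strategy.fm)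
      else Strategy.b)
  else none

variable {net} in
/-- The actions of all UEs in a slot. -/
def actions (x : net.SlotNoise) : Fin net.N → Option Strategy := fun v => net.action (x.1 v)

variable {net} in
/-- Number of UEs in a slot that use strategy `s`. -/
def numUsing (x : net.SlotNoise) (s : Strategy) : ℕ :=
  #{w : Fin net.N | actions x w = some s}

variable {net} in
/-- Number of UEs other than `v` in a slot that use strategy `s`. -/
def numOthers (x : net.SlotNoise) (v : Fin net.N) (s : Strategy) : ℕ :=
  #{w : Fin net.N | w ≠ v ∧ actions x w = some s}

variable {net} in
/-- The packet of UE `v` enters the relay queue: it was sent to the relay and decoded there, or it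
was broadcast, decoded at the relay, and not received by the mmAP. The flag `r` says whether
the relay transmits in the slot. -/
def Enters (r : Bool) (x : net.SlotNoise) (v : Fin net.N) : Prop :=
  (actions x v = some Strategy.fr ∧
    (x.2.1 v).1 < net.Purf (numOthers x v Strategy.fr) (numOthers x v Strategy.b)) ∨
  (actions x v = some Strategy.b ∧
    (x.2.1 v).1 < net.Purb (numOthers x v Strategy.fr) (numOthers x v Strategy.b) ∧
    ¬ (x.2.1 v).2 < net.Pudb (numOthers x v Strategy.fm) r (numOthers x v Strategy.b))

variable {net} in
open Classical in
/-- Number of packets that enter the relay queue in a slot. -/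
def arrivals (r : Bool) (x : net.SlotNoise) : ℕ := #{v : Fin net.N | Enters r x v}

variable {net} in
/-- The relay transmits: its queue, of length `n`, is not empty, and it decides to transmit. -/
def relayTransmits (qr : I) (n : ℕ) (x : net.SlotNoise) : Bool := decide (n ≠ 0 ∧ x.2.2.1 < qr)

variable {net} in
/-- Number (0 or 1) of packets that leave the relay queue in a slot. -/
def departures (r : Bool) (x : net.SlotNoise) : ℕ :=
  if r = true ∧ x.2.2.2 < net.Prdf (numUsing x Strategy.fm) (numUsing x Strategy.b) then 1 else 0

variable {net} in
/-- Queue length after a slot that starts with queue length `n`. -/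
def step (qr : I) (n : ℕ) (x : net.SlotNoise) : ℕ :=
  n - departures (relayTransmits qr n x) x + arrivals (relayTransmits qr n x) x

variable {net} in
/-- Length of the relay queue at time `t`, starting from length `n`. -/
def queue (qr : I) (n : ℕ) (ω : ℕ → net.SlotNoise) : ℕ → ℕ
  | 0 => n
  | t + 1 => step qr (queue qr n ω t) (ω t)

/-- The law of the noise: independent and identically distributed slots. -/
def law : Measure (ℕ → net.SlotNoise) :=
  Measure.infinitePi (fun _ : ℕ => (volume : Measure net.SlotNoise))

variable {net} in
/-- First time `t ≥ 1` at which the queue is empty (`∞` if there is none). -/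
def returnTime (qr : I) (n : ℕ) (ω : ℕ → net.SlotNoise) : ℝ≥0∞ :=
  ⨅ t : ℕ, ⨅ _ : 1 ≤ t ∧ queue qr n ω t = 0, (t : ℝ≥0∞)

/-- Stability, as positive recurrence of the Markov chain of queue lengths: from every initial
length, the mean time until the queue is (next) empty is finite. -/
def Stable (qr : I) : Prop :=
  ∀ n : ℕ, ∫⁻ ω, returnTime qr n ω ∂net.law < ∞

/-! ### The explicit arrival and service expressions -/

/-- The probability that the relay receives `k` packets in a slot, given that it transmits
(`r = true`) or that it does not (`r = false`): `m` UEs transmit, `i` of them use the directional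
scheme, `j` of these `i` transmit to the relay, `kf` of these `j` are received. -/
def recv (r : Bool) (k : ℕ) : ℝ :=
  ∑ m ∈ Icc k net.N, (net.N.choose m : ℝ) * net.qtx ^ m * (1 - net.qtx) ^ (net.N - m) *
    ∑ i ∈ Icc 0 m, (m.choose i : ℝ) * (net.quf : ℝ) ^ i * net.qub ^ (m - i) *
      ∑ j ∈ Icc (k + i - m) i, (i.choose j : ℝ) * (net.qur : ℝ) ^ j * net.qum ^ (i - j) *
        ∑ kf ∈ Icc (k + i - m) (min j k),
          (j.choose kf : ℝ) * (net.Purf (j - 1) (m - i) : ℝ) ^ kf *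
            (1 - (net.Purf (j - 1) (m - i) : ℝ)) ^ (j - kf) *
          (((m - i).choose (k - kf) : ℝ) *
            (net.Purb j (m - i - 1) * (1 - (net.Pudb (i - j) r (m - i - 1) : ℝ))) ^ (k - kf) *
            (1 - net.Purb j (m - i - 1) * (1 - (net.Pudb (i - j) r (m - i - 1) : ℝ)))
              ^ (m - i - (k - kf)))

/-- `λ_r^0`, the arrival rate when the queue is empty. -/
def lambda0 : ℝ := ∑ k ∈ Icc 1 net.N, (k : ℝ) * net.recv false k

/-- `A_r`, the arrival rate when the relay transmits. -/
def A : ℝ := ∑ k ∈ Icc 1 net.N, (k : ℝ) * net.recv true k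

/-- `B_r`, the success probability of a transmission of the relay. -/
def B : ℝ :=
  ∑ m ∈ Icc 0 net.N, (net.N.choose m : ℝ) * net.qtx ^ m * (1 - net.qtx) ^ (net.N - m) *
    ∑ i ∈ Icc 0 m, (m.choose i : ℝ) * (net.quf : ℝ) ^ i * net.qub ^ (m - i) *
      ∑ j ∈ Icc 0 i, (i.choose j : ℝ) * (net.qur : ℝ) ^ j * net.qum ^ (i - j) *
        net.Prdf (i - j) (m - i)

/-- `λ_r^1`, the arrival rate when the queue is not empty. -/
def lambda1 (qr : I) : ℝ := (1 - qr) * net.lambda0 + qr * net.A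

/-- `μ_r`, the service rate. -/
def mu (qr : I) : ℝ := qr * net.B

/-- `q_rmin`. -/
def qrmin : ℝ := net.lambda0 / (net.lambda0 + net.B - net.A)

/-- The arrival rate written out for two UEs, when the relay transmits (`r = true`) or does not
(`r = false`). -/
def arrivalTwo (r : Bool) : ℝ :=
  let q : ℝ := net.qtx
  let f : ℝ := net.quf
  let b : ℝ := net.qub
  let ur : ℝ := net.qur
  let um : ℝ := net.qum
  let Pf : ℕ → ℕ → ℝ := fun j l => net.Purf j l
  let Pb : ℕ → ℕ → ℝ := fun j l => net.Purb j l
  let Fd : ℕ → ℕ → ℝ := fun i l => 1 - net.Pudb i r l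
  2 * q * (1 - q) * f * ur * Pf 0 0
  + 2 * q * (1 - q) * b * Pb 0 0 * Fd 0 0
  + q ^ 2 * f ^ 2 * ur ^ 2 * (2 * Pf 1 0 * (1 - Pf 1 0) + 2 * Pf 1 0 ^ 2)
  + 2 * q ^ 2 * f ^ 2 * ur * um * Pf 0 0
  + 2 * q ^ 2 * f * b * ur *
      (Pf 0 1 * (1 - Pb 1 0 * Fd 0 0) + (1 - Pf 0 1) * Pb 1 0 * Fd 0 0
        + 2 * Pf 0 1 * (Pb 1 0 * Fd 0 0))
  + 2 * q ^ 2 * b * f * um * Pb 0 0 * Fd 1 0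
  + q ^ 2 * b ^ 2 *
      (2 * (Pb 0 1 * Fd 0 1) * (1 - Pb 0 1 * Fd 0 1) + 2 * (Pb 0 1 * Fd 0 1) ^ 2)

/-- The success probability of a transmission of the relay, written out for two UEs. -/
def serviceTwo : ℝ :=
  let q : ℝ := net.qtx
  let f : ℝ := net.quf
  let b : ℝ := net.qub
  let ur : ℝ := net.qur
  let um : ℝ := net.qum
  let P : ℕ → ℕ → ℝ := fun i l => net.Prdf i l
  P 0 0 * ((1 - q) ^ 2 + 2 * q * (1 - q) * f * ur + q ^ 2 * f ^ 2 * ur ^ 2)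
  + P 1 0 * (2 * q * (1 - q) * f * um + 2 * q ^ 2 * f ^ 2 * um * ur)
  + P 0 1 * (2 * q * (1 - q) * b + 2 * q ^ 2 * b * f * ur)
  + P 2 0 * (q ^ 2 * f ^ 2 * um ^ 2)
  + P 1 1 * (2 * q ^ 2 * f * b * um)
  + P 0 2 * (q ^ 2 * b ^ 2)

end

end RelayNetwork

/-!
The queue length, started anywhere and stopped when it returns to `0`, has increments whose
conditional mean is the constant drift `δ = λ_r^1 - μ_r` as long as it is positive. Let `X t` be
the stopped length at time `t + 1` (`excursion`). As the noise of a slot is independent of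
the past, `E[X (t+1)] = E[X t] + δ P(X t ≠ 0)` (`integral_excursion_succ`), and the mean return time
is `1 + ∑ P(X t ≠ 0)` (`lintegral_returnTime`).

* If `δ < 0`, then `X ≥ 0` bounds the partial sums of `P(X t ≠ 0)` by `E[X 0] / |δ|`
  (`stable_of_lt`).
* If `δ ≥ 0`, then starting from `1` gives `E[X t] ≥ 1`, whereas `X t ≤ (N + 1) (t + 1)`. Hence
  `P(X t ≠ 0) ≥ 1 / ((N + 1) (t + 1))`, and the harmonic series diverges (`not_stable_of_le`).

That the drift is the one given by the explicit rates (`integral_step`) follows by conditioning on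
the actions of all UEs: once they are fixed, every event that matters is a box in the noise space.
The resulting averages over action profiles only depend on how many UEs use each strategy, and are
turned into iterated binomial sums by induction on the number of UEs (`sum_prod_mul_card`). In the
arrival rate the distribution `recv` of the number of arrivals is, given the actions, that of a sum
of two independent binomial variables, of which only the mean enters
(`sum_mul_binomial_convolution`, `sum_mul_recv`).

The conditions on the relay transmit probability rephrase `δ < 0`, which is affine in it, using
`0 ≤ λ_r^0`. For two UEs the iterated sums are expanded.
-/

/-! ### Binomial and multinomial sums -/

/-- The sum `∑ C(n,a) xᵃ yᵇ G(a,b)` over `a + b = n`; for `x + y = 1` it is the expectation of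
`G(S, n - S)` for a binomial variable `S`. -/
def binomSum (x y : ℝ) (n : ℕ) (G : ℕ → ℕ → ℝ) : ℝ :=
  ∑ p ∈ antidiagonal n, (n.choose p.1 : ℝ) * (x ^ p.1 * y ^ p.2 * G p.1 p.2)

theorem binomSum_zero (x y : ℝ) (G : ℕ → ℕ → ℝ) : binomSum x y 0 G = G 0 0 := by
  simp [binomSum]

theorem binomSum_succ (x y : ℝ) (n : ℕ) (G : ℕ → ℕ → ℝ) :
    binomSum x y (n + 1) G =
      x * binomSum x y n (fun a b => G (a + 1) b) +
        y * binomSum x y n (fun a b => G a (b + 1)) := by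
  unfold binomSum
  rw [Finset.sum_antidiagonal_choose_succ_mul (fun a b => x ^ a * y ^ b * G a b), add_comm,
    mul_sum, mul_sum]
  congr 1
  all_goals
    refine sum_congr rfl fun p _ => ?_
  · rw [Nat.choose_symm_of_eq_add (mem_antidiagonal.1 ‹_›).symm]
    ring
  · ring

theorem binomSum_eq_sum_Icc (x y : ℝ) (n : ℕ) (G : ℕ → ℕ → ℝ) :
    binomSum x y n G = ∑ a ∈ Icc 0 n, (n.choose a : ℝ) * x ^ a * y ^ (n - a) * G a (n - a) := by
  unfold binomSum
  rw [Finset.Nat.sum_antidiagonal_eq_sum_range_succ_mk, ← Nat.range_succ_eq_Icc_zero]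
  exact sum_congr rfl fun a _ => by ring

theorem binomSum_add (x y : ℝ) (n : ℕ) (G H : ℕ → ℕ → ℝ) :
    binomSum x y n (fun a b => G a b + H a b) = binomSum x y n G + binomSum x y n H := by
  simp only [binomSum, mul_add, sum_add_distrib]

theorem binomSum_const_mul (x y c : ℝ) (n : ℕ) (G : ℕ → ℕ → ℝ) :
    binomSum x y n (fun a b => c * G a b) = c * binomSum x y n G := by
  simp only [binomSum, mul_sum]
  exact sum_congr rfl fun _ _ => by ring

theorem binomSum_one {x y : ℝ} (h : x + y = 1) (n : ℕ) : binomSum x y n (fun _ _ => 1) = 1 := by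
  induction n with
  | zero => simp [binomSum_zero]
  | succ n ih => rw [binomSum_succ, ih]; linarith

theorem binomSum_fst {x y : ℝ} (h : x + y = 1) (n : ℕ) :
    binomSum x y n (fun a _ => (a : ℝ)) = n * x := by
  induction n with
  | zero => simp [binomSum_zero]
  | succ n ih =>
    rw [binomSum_succ]
    push_cast
    rw [binomSum_add, ih, binomSum_one h]
    linear_combination (n : ℝ) * x * h

theorem binomSum_const {x y : ℝ} (h : x + y = 1) (n : ℕ) (c : ℝ) :
    binomSum x y n (fun _ _ => c) = c := by
  simpa [binomSum_one h] using binomSum_const_mul x y c n (fun _ _ => 1)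

/-- The mean of the sum of two independent binomial variables, with the distribution of the sum
written as a convolution. -/
theorem sum_mul_binomial_convolution {x y : ℝ} {J L N : ℕ} (h : J + L ≤ N) :
    ∑ k ∈ Icc 1 N, (k : ℝ) * ∑ a ∈ Icc (k - L) (min J k),
      (J.choose a : ℝ) * x ^ a * (1 - x) ^ (J - a) *
        ((L.choose (k - a) : ℝ) * y ^ (k - a) * (1 - y) ^ (L - (k - a))) = J * x + L * y := by
  -- Both sides are the mean of `a + b` over all pairs `(a, b)`, which the left side groups by the
  -- value `k` of `a + b`.
  have key : binomSum x (1 - x) J (fun a _ => binomSum y (1 - y) L (fun b _ => (a : ℝ) + b))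
      = J * x + L * y := by
    have e (a : ℕ) : binomSum y (1 - y) L (fun b _ => (a : ℝ) + b) = a + L * y := by
      rw [binomSum_add, binomSum_const (by ring), binomSum_fst (by ring)]
    simp only [e]
    rw [binomSum_add, binomSum_const (by ring), binomSum_fst (by ring)]
  rw [← key]
  simp only [binomSum_eq_sum_Icc, mul_sum]
  rw [← sum_product', sum_sigma', ← sum_filter_of_ne (p := fun p : ℕ × ℕ => 1 ≤ p.1 + p.2)]
  · refine sum_nbij' (fun p => (p.2, p.1 - p.2)) (fun p => ⟨p.1 + p.2, p.1⟩) ?_ ?_ ?_ ?_ ?_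
    · rintro ⟨k, a⟩ hk
      simp only [mem_sigma, mem_Icc, mem_filter, mem_product] at hk ⊢
      omega
    · rintro ⟨a, b⟩ hk
      simp only [mem_sigma, mem_Icc, mem_filter, mem_product] at hk ⊢
      omega
    · rintro ⟨k, a⟩ hk
      simp only [mem_sigma, mem_Icc] at hk
      simp only [Sigma.mk.injEq, heq_eq_eq, and_true]
      omega
    · rintro ⟨a, b⟩ _
      simp
    · rintro ⟨k, a⟩ hk
      simp only [mem_sigma, mem_Icc] at hk
      have hak : a ≤ k := by omega
      push_cast [Nat.cast_sub hak]
      ring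
  · rintro ⟨a, b⟩ _ hne
    by_contra hlt
    obtain ⟨rfl, rfl⟩ : a = 0 ∧ b = 0 := by simp only at hlt; omega
    simp at hne

instance : Fintype Strategy :=
  ⟨{Strategy.fm, Strategy.fr, Strategy.b}, fun s => by cases s <;> decide⟩

theorem Strategy.sum_option {M : Type*} [AddCommMonoid M] (g : Option Strategy → M) :
    ∑ s, g s = g none + (g (some Strategy.fm) + (g (some Strategy.fr) + g (some Strategy.b))) := by
  rw [Fintype.sum_option]
  congr 1
  change ∑ s ∈ ({Strategy.fm, Strategy.fr, Strategy.b} : Finset Strategy), _ = _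
  rw [sum_insert (by decide), sum_insert (by decide), sum_singleton]

theorem Fin.sum_pi_succ {α M : Type*} [Fintype α] [AddCommMonoid M] {n : ℕ}
    (G : (Fin (n + 1) → α) → M) :
    ∑ a, G a = ∑ s, ∑ a : Fin n → α, G (Fin.cons s a) := by
  rw [← Fintype.sum_prod_type' (f := fun (s : α) (a : Fin n → α) => G (Fin.cons s a))]
  exact (Equiv.sum_comp (Fin.consEquiv fun _ => α) G).symm

theorem Fin.card_cons_eq {α : Type*} [DecidableEq α] {n : ℕ} (s t : α) (a : Fin n → α) :
    #{w | (Fin.cons s a : Fin (n + 1) → α) w = t} = (if s = t then 1 else 0) + #{w | a w = t} := by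
  simp only [card_filter, Fin.sum_univ_succ, Fin.cons_zero, Fin.cons_succ]

/-- If every one of `n` UEs independently chooses an action, then the numbers of UEs that use the
strategies are distributed as in a successive binomial choice of the transmitting UEs, of the
directional ones among them, and of those directed to the relay among the latter. -/
theorem sum_prod_mul_card (p : Option Strategy → ℝ) {q q' f f' u u' : ℝ}
    (hn : p none = q') (hb : p (some Strategy.b) = q * f')
    (hr : p (some Strategy.fr) = q * f * u) (hm : p (some Strategy.fm) = q * f * u')
    (n : ℕ) (F : ℕ → ℕ → ℕ → ℝ) :
    ∑ a : Fin n → Option Strategy, (∏ v, p (a v)) *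
        F #{w | a w = some Strategy.fm} #{w | a w = some Strategy.fr} #{w | a w = some Strategy.b} =
      binomSum q q' n fun m _ => binomSum f f' m fun i l => binomSum u u' i fun j h => F h j l := by
  induction n generalizing F with
  | zero => simp [binomSum_zero]
  | succ n ih =>
    rw [Fin.sum_pi_succ, Strategy.sum_option]
    simp only [Fin.prod_univ_succ, Fin.cons_zero, Fin.cons_succ, Fin.card_cons_eq,
      Option.some.injEq, reduceCtorEq, if_true, if_false, zero_add, mul_assoc, ← mul_sum]
    simp only [add_comm 1]
    rw [ih F, ih fun h j l => F (h + 1) j l, ih fun h j l => F h (j + 1) l,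
      ih fun h j l => F h j (l + 1), binomSum_succ, hn, hb, hr, hm]
    simp only [binomSum_succ, binomSum_add, binomSum_const_mul]
    ring

namespace RelayNetwork

noncomputable section

variable (net : RelayNetwork)

/-! ### Rates as averages over the actions of the UEs -/

/-- Probability that a UE takes a given action. -/
def actionProb : Option Strategy → ℝ
  | none => 1 - net.qtx
  | some Strategy.fm => net.qtx * net.quf * net.qum
  | some Strategy.fr => net.qtx * net.quf * net.qur
  | some Strategy.b => net.qtx * net.qub

/-- Probability that all UEs take given actions. -/
def actionsProb (a : Fin net.N → Option Strategy) : ℝ := ∏ v, net.actionProb (a v)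

variable {net} in
/-- Probability that the packet of UE `v` enters the relay queue, given the actions of all UEs. -/
def enterProb (r : Bool) (a : Fin net.N → Option Strategy) (v : Fin net.N) : ℝ :=
  match a v with
  | some Strategy.fr =>
    net.Purf #{w | w ≠ v ∧ a w = some Strategy.fr} #{w | w ≠ v ∧ a w = some Strategy.b}
  | some Strategy.b =>
    net.Purb #{w | w ≠ v ∧ a w = some Strategy.fr} #{w | w ≠ v ∧ a w = some Strategy.b} *
      (1 - net.Pudb #{w | w ≠ v ∧ a w = some Strategy.fm} r #{w | w ≠ v ∧ a w = some Strategy.b})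
  | _ => 0

/-- Mean number of arrivals when the relay transmits (`r = true`) or does not (`r = false`). -/
def arrivalRate (r : Bool) : ℝ := ∑ a, net.actionsProb a * ∑ v, enterProb r a v

theorem card_others_eq {n : ℕ} (a : Fin n → Option Strategy) (v : Fin n) (s : Option Strategy) :
    #{w | w ≠ v ∧ a w = s} = #{w | a w = s} - if a v = s then 1 else 0 := by
  have : ({w | w ≠ v ∧ a w = s} : Finset (Fin n)) = ({w | a w = s} : Finset (Fin n)).erase v := by
    ext w; simp
  rw [this, card_erase_eq_ite]
  simp only [mem_filter, mem_univ, true_and]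
  split_ifs <;> simp

theorem sum_enterProb (r : Bool) (a : Fin net.N → Option Strategy) :
    ∑ v, enterProb r a v =
      #{w | a w = some Strategy.fr} *
          (net.Purf (#{w | a w = some Strategy.fr} - 1) #{w | a w = some Strategy.b} : ℝ) +
        #{w | a w = some Strategy.b} *
          (net.Purb #{w | a w = some Strategy.fr} (#{w | a w = some Strategy.b} - 1) *
            (1 - net.Pudb #{w | a w = some Strategy.fm} r
              (#{w | a w = some Strategy.b} - 1) : ℝ)) := by
  have hc (s : Option Strategy) : (#{w | a w = s} : ℝ) = ∑ v, if a v = s then 1 else 0 := by simp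
  rw [hc, hc, sum_mul, sum_mul, ← sum_add_distrib]
  refine sum_congr rfl fun v _ => ?_
  unfold enterProb
  simp only [card_others_eq]
  rcases a v with _ | _ | _ | _ <;> simp

theorem sum_actionsProb_mul_card (F : ℕ → ℕ → ℕ → ℝ) :
    ∑ a, net.actionsProb a *
        F #{w | a w = some Strategy.fm} #{w | a w = some Strategy.fr} #{w | a w = some Strategy.b} =
      ∑ m ∈ Icc 0 net.N, (net.N.choose m : ℝ) * net.qtx ^ m * (1 - net.qtx) ^ (net.N - m) *
        ∑ i ∈ Icc 0 m, (m.choose i : ℝ) * (net.quf : ℝ) ^ i * net.qub ^ (m - i) *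
          ∑ j ∈ Icc 0 i, (i.choose j : ℝ) * (net.qur : ℝ) ^ j * net.qum ^ (i - j) *
            F (i - j) j (m - i) := by
  unfold actionsProb
  rw [sum_prod_mul_card net.actionProb rfl rfl rfl rfl]
  simp only [binomSum_eq_sum_Icc, actionProb]

theorem B_eq_sum : net.B = ∑ a, net.actionsProb a *
    (net.Prdf #{w | a w = some Strategy.fm} #{w | a w = some Strategy.b} : ℝ) :=
  (net.sum_actionsProb_mul_card fun h _ l => (net.Prdf h l : ℝ)).symm

theorem recv_eq_sum_Icc (r : Bool) (k : ℕ) : net.recv r k =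
    ∑ m ∈ Icc 0 net.N, (net.N.choose m : ℝ) * net.qtx ^ m * (1 - net.qtx) ^ (net.N - m) *
      ∑ i ∈ Icc 0 m, (m.choose i : ℝ) * (net.quf : ℝ) ^ i * net.qub ^ (m - i) *
        ∑ j ∈ Icc 0 i, (i.choose j : ℝ) * (net.qur : ℝ) ^ j * net.qum ^ (i - j) *
          ∑ kf ∈ Icc (k - (m - i)) (min j k),
            (j.choose kf : ℝ) * (net.Purf (j - 1) (m - i) : ℝ) ^ kf *
              (1 - (net.Purf (j - 1) (m - i) : ℝ)) ^ (j - kf) *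
            (((m - i).choose (k - kf) : ℝ) *
              (net.Purb j (m - i - 1) * (1 - (net.Pudb (i - j) r (m - i - 1) : ℝ))) ^ (k - kf) *
              (1 - net.Purb j (m - i - 1) * (1 - (net.Pudb (i - j) r (m - i - 1) : ℝ)))
                ^ (m - i - (k - kf))) := by
  unfold recv
  -- Outside the original ranges of `m` and `j` the innermost sum is empty.
  refine sum_subset_zero_on_sdiff (Icc_subset_Icc_left k.zero_le) (fun m hm => ?_) fun m _ => ?_
  · simp only [mem_sdiff, mem_Icc] at hm
    refine mul_eq_zero_of_right _ (sum_eq_zero fun i hi => mul_eq_zero_of_right _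
      (sum_eq_zero fun j hj => mul_eq_zero_of_right _ ?_))
    rw [mem_Icc] at hi hj
    rw [Icc_eq_empty (by omega), sum_empty]
  · refine congrArg _ (sum_congr rfl fun i hi => congrArg _ ?_)
    rw [mem_Icc] at hi
    refine sum_subset_zero_on_sdiff (Icc_subset_Icc_left (Nat.zero_le _)) (fun j hj => ?_)
      fun j _ => ?_
    · simp only [mem_sdiff, mem_Icc] at hj
      rw [Icc_eq_empty (by omega), sum_empty, mul_zero]
    · rw [show k + i - m = k - (m - i) by omega]

theorem sum_mul_recv (r : Bool) :
    ∑ k ∈ Icc 1 net.N, (k : ℝ) * net.recv r k = net.arrivalRate r := by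
  unfold arrivalRate
  simp only [sum_enterProb]
  rw [net.sum_actionsProb_mul_card fun h j l => j * (net.Purf (j - 1) l : ℝ) +
    l * (net.Purb j (l - 1) * (1 - net.Pudb h r (l - 1) : ℝ))]
  simp only [recv_eq_sum_Icc]
  simp only [mul_sum (s := Icc 0 _)]
  rw [sum_comm]
  refine sum_congr rfl fun m hm => ?_
  rw [sum_comm]
  refine sum_congr rfl fun i hi => ?_
  rw [sum_comm]
  refine sum_congr rfl fun j hj => ?_
  rw [mem_Icc] at hm hi hj
  rw [← sum_mul_binomial_convolution (show j + (m - i) ≤ net.N by omega)]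
  simp only [mul_sum (s := Icc 1 _)]
  refine sum_congr rfl fun k _ => ?_
  ring

theorem lambda0_eq : net.lambda0 = net.arrivalRate false := net.sum_mul_recv false

theorem A_eq : net.A = net.arrivalRate true := net.sum_mul_recv true

/-! ### Two UEs -/

theorem arrivalRate_two (r : Bool) (h : net.N = 2) : net.arrivalRate r = net.arrivalTwo r := by
  have e (n : ℕ) (g : ℕ → ℝ) : ∑ k ∈ Icc 0 n, g k = ∑ k ∈ range (n + 1), g k := by
    rw [Nat.range_succ_eq_Icc_zero]
  unfold arrivalRate
  simp only [sum_enterProb]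
  rw [net.sum_actionsProb_mul_card fun h j l => j * (net.Purf (j - 1) l : ℝ) +
    l * (net.Purb j (l - 1) * (1 - net.Pudb h r (l - 1) : ℝ))]
  simp [h, e, sum_range_succ, arrivalTwo]
  ring

theorem B_eq_serviceTwo (h : net.N = 2) : net.B = net.serviceTwo := by
  have e (n : ℕ) (g : ℕ → ℝ) : ∑ k ∈ Icc 0 n, g k = ∑ k ∈ range (n + 1), g k := by
    rw [Nat.range_succ_eq_Icc_zero]
  simp [B, h, e, sum_range_succ, serviceTwo]
  ring

/-! ### One slot of the queue -/

theorem qtx_mem : net.qtx ∈ I := by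
  have hq := net.qu.2.1
  have hf0 := net.quf.2.1
  have hf1 := net.quf.2.2
  have hr0 := net.qur.2.1
  have hr1 := net.qur.2.2
  have hb0 : 0 ≤ net.qub := sub_nonneg.2 hf1
  have hm0 : 0 ≤ net.qum := sub_nonneg.2 hr1
  -- The three squares add up to at most the square of `quf * qum + quf * qur + qub = 1`.
  have hs : 0 ≤ 1 - (net.quf * net.qum) ^ 2 - ((net.quf : ℝ) * net.qur) ^ 2 - net.qub ^ 2 := by
    have h1 : 1 = net.quf * net.qum + (net.quf : ℝ) * net.qur + net.qub := by
      unfold qub qum; ring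
    have h2 := mul_nonneg hf0 hm0
    have h3 := mul_nonneg hf0 hr0
    have h4 := mul_nonneg h2 h3
    have h5 := mul_nonneg h2 hb0
    have h6 := mul_nonneg h3 hb0
    have h7 := congrArg (· ^ 2) h1
    ring_nf at h7 h4 h5 h6 ⊢
    linarith
  have hd := mul_nonneg (mul_nonneg (Nat.cast_nonneg (α := ℝ) net.Da) hq) hs
  unfold qtx
  exact ⟨div_nonneg hq (by linarith), div_le_one_of_le₀ (by linarith [net.qu.2.2]) (by linarith)⟩

theorem volume_real_Iio (p : I) : volume.real (Set.Iio p) = (p : ℝ) := by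
  rw [measureReal_def, unitInterval.volume_Iio, ENNReal.toReal_ofReal p.2.1]

theorem volume_real_Ici (p : I) : volume.real (Set.Ici p) = 1 - (p : ℝ) := by
  rw [measureReal_def, unitInterval.volume_Ici, ENNReal.toReal_ofReal (by linarith [p.2.2])]

/-- The values of the noise of a UE that lead to a given action. -/
theorem setOf_action_eq (s : Option Strategy) : {u | net.action u = s} = match s with
    | none => Set.Ici ⟨net.qtx, net.qtx_mem⟩ ×ˢ Set.univ
    | some Strategy.fm => Set.Iio ⟨net.qtx, net.qtx_mem⟩ ×ˢ Set.Iio net.quf ×ˢ Set.Ici net.qur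
    | some Strategy.fr => Set.Iio ⟨net.qtx, net.qtx_mem⟩ ×ˢ Set.Iio net.quf ×ˢ Set.Iio net.qur
    | some Strategy.b => Set.Iio ⟨net.qtx, net.qtx_mem⟩ ×ˢ Set.Ici net.quf ×ˢ Set.univ := by
  ext ⟨u, u', u''⟩
  have h : u < ⟨net.qtx, net.qtx_mem⟩ ↔ (u : ℝ) < net.qtx := Iff.rfl
  rcases s with _ | _ | _ | _ <;>
    simp only [Set.mem_ofPred_eq, action, Set.mem_prod, Set.mem_Ici, Set.mem_Iio, Set.mem_univ, h,
      ← not_lt] <;>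
    split_ifs <;> simp_all

theorem measurableSet_action_eq (s : Option Strategy) : MeasurableSet {u | net.action u = s} := by
  rw [setOf_action_eq]
  rcases s with _ | _ | _ | _ <;> simp only <;> measurability

theorem volume_action_eq (s : Option Strategy) :
    volume.real {u | net.action u = s} = net.actionProb s := by
  rw [setOf_action_eq]
  rcases s with _ | _ | _ | _ <;>
    simp only [Measure.volume_eq_prod, measureReal_prod_prod, volume_real_Iio, volume_real_Ici,
      probReal_univ, actionProb, qub, qum] <;> ring

variable {net} in
/-- The slots in which the UEs take the actions `a`, with constraints on the other variables. -/
def rect (a : Fin net.N → Option Strategy) (S : Set (Fin net.N → I × I)) (U W : Set I) :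
    Set net.SlotNoise :=
  (Set.univ.pi fun v => {u | net.action u = a v}) ×ˢ S ×ˢ U ×ˢ W

variable {net} in
theorem mem_rect {a : Fin net.N → Option Strategy} {S : Set (Fin net.N → I × I)} {U W : Set I}
    {x : net.SlotNoise} :
    x ∈ rect a S U W ↔ actions x = a ∧ x.2.1 ∈ S ∧ x.2.2.1 ∈ U ∧ x.2.2.2 ∈ W := by
  simp [rect, actions, funext_iff, Set.mem_prod]

variable {net} in
theorem measurableSet_rect (a : Fin net.N → Option Strategy) {S : Set (Fin net.N → I × I)}
    {U W : Set I} (hS : MeasurableSet S) (hU : MeasurableSet U) (hW : MeasurableSet W) :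
    MeasurableSet (rect a S U W) :=
  (MeasurableSet.univ_pi fun v => net.measurableSet_action_eq (a v)).prod (hS.prod (hU.prod hW))

variable {net} in
theorem volume_rect (a : Fin net.N → Option Strategy) (S : Set (Fin net.N → I × I)) (U W : Set I) :
    volume.real (rect a S U W) =
      net.actionsProb a * (volume.real S * (volume.real U * volume.real W)) := by
  have h : volume.real (Set.univ.pi fun v => {u | net.action u = a v}) = net.actionsProb a := by
    rw [measureReal_def, volume_pi_pi, ENNReal.toReal_prod]
    exact prod_congr rfl fun v _ => net.volume_action_eq (a v)
  rw [rect, Measure.volume_eq_prod, measureReal_prod_prod, h, Measure.volume_eq_prod,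
    measureReal_prod_prod, Measure.volume_eq_prod, measureReal_prod_prod]

variable {net} in
/-- The reception variables of UE `v` with which its packet enters the relay queue, given the
actions of all UEs. -/
def enterSet (r : Bool) (a : Fin net.N → Option Strategy) (v : Fin net.N) : Set (I × I) :=
  match a v with
  | some Strategy.fr => Set.Iio
      (net.Purf #{w | w ≠ v ∧ a w = some Strategy.fr} #{w | w ≠ v ∧ a w = some Strategy.b}) ×ˢ
      Set.univ
  | some Strategy.b => Set.Iio
      (net.Purb #{w | w ≠ v ∧ a w = some Strategy.fr} #{w | w ≠ v ∧ a w = some Strategy.b}) ×ˢ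
      Set.Ici
        (net.Pudb #{w | w ≠ v ∧ a w = some Strategy.fm} r #{w | w ≠ v ∧ a w = some Strategy.b})
  | _ => ∅

variable {net} in
theorem enters_iff (r : Bool) (x : net.SlotNoise) (v : Fin net.N) :
    Enters r x v ↔ x.2.1 v ∈ enterSet r (actions x) v := by
  unfold Enters enterSet numOthers
  rcases actions x v with _ | _ | _ | _ <;> simp [Set.mem_prod]

variable {net} in
theorem measurableSet_enterSet (r : Bool) (a : Fin net.N → Option Strategy) (v : Fin net.N) :
    MeasurableSet (enterSet r a v) := by
  unfold enterSet
  rcases a v with _ | _ | _ | _ <;> simp only <;> measurability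

variable {net} in
theorem volume_enterSet (r : Bool) (a : Fin net.N → Option Strategy) (v : Fin net.N) :
    volume.real (enterSet r a v) = enterProb r a v := by
  unfold enterSet enterProb
  rcases a v with _ | _ | _ | _ <;>
    simp [Measure.volume_eq_prod, measureReal_prod_prod, volume_real_Iio, volume_real_Ici]

variable {net} in
theorem volume_eval_enterSet (r : Bool) (a : Fin net.N → Option Strategy) (v : Fin net.N) :
    volume.real {y : Fin net.N → I × I | y v ∈ enterSet r a v} = enterProb r a v := by
  rw [← volume_enterSet, measureReal_def, measureReal_def,
    ← (measurePreserving_eval (fun _ : Fin net.N => (volume : Measure (I × I))) v).measure_preimage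
      (measurableSet_enterSet r a v).nullMeasurableSet]
  rfl

variable {net} in
theorem arrivals_eq_sum (r : Bool) (x : net.SlotNoise) :
    arrivals r x = ∑ a, ∑ v, (rect a {y | y v ∈ enterSet r a v} Set.univ
      Set.univ).indicator (fun _ => 1) x := by
  classical
  rw [sum_eq_single (actions x)]
  · simp [arrivals, Set.indicator_apply, mem_rect, enters_iff]
  · intro a _ ha
    exact sum_eq_zero fun v _ => Set.indicator_of_notMem (fun h => ha (mem_rect.1 h).1.symm) _
  · simp

variable {net} in
theorem departures_eq_sum (x : net.SlotNoise) :
    departures true x = ∑ a, (rect a Set.univ Set.univ (Set.Iio (net.Prdf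
      #{w | a w = some Strategy.fm} #{w | a w = some Strategy.b}))).indicator (fun _ => 1) x := by
  classical
  rw [sum_eq_single (actions x)]
  · simp [departures, numUsing, Set.indicator_apply, mem_rect]
  · intro a _ ha
    exact Set.indicator_of_notMem (fun h => ha (mem_rect.1 h).1.symm) _
  · simp

variable {net} in
theorem measurable_arrivals (r : Bool) : Measurable (arrivals (net := net) r) := by
  rw [funext (arrivals_eq_sum r)]
  exact Finset.measurable_sum _ fun a _ => Finset.measurable_sum _ fun v _ =>
    measurable_const.indicator (measurableSet_rect a
      (measurable_pi_apply v (measurableSet_enterSet r a v)) .univ .univ)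

variable {net} in
theorem measurable_departures : Measurable (departures (net := net) true) := by
  rw [funext departures_eq_sum]
  exact Finset.measurable_sum _ fun a _ =>
    measurable_const.indicator (measurableSet_rect a .univ .univ measurableSet_Iio)

variable {net} in
theorem arrivals_le (r : Bool) (x : net.SlotNoise) : arrivals r x ≤ net.N := by
  classical
  exact (card_filter_le _ _).trans (by simp)

theorem setIntegral_arrivals (r : Bool) {U : Set I} (hU : MeasurableSet U) :
    ∫ x : net.SlotNoise, {x : net.SlotNoise | x.2.2.1 ∈ U}.indicator (fun x => (arrivals r x : ℝ)) x
      = volume.real U * net.arrivalRate r := by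
  have h (x : net.SlotNoise) :
      {x : net.SlotNoise | x.2.2.1 ∈ U}.indicator (fun x => (arrivals r x : ℝ)) x =
        ∑ a, ∑ v, (rect a {y | y v ∈ enterSet r a v} U Set.univ).indicator
          (1 : net.SlotNoise → ℝ) x := by
    classical
    by_cases hx : x.2.2.1 ∈ U <;>
      simp [Set.indicator_apply, arrivals_eq_sum, mem_rect, hx]
  have hm (a v) : MeasurableSet (rect (net := net) a {y | y v ∈ enterSet r a v} U
      Set.univ) :=
    measurableSet_rect a (measurable_pi_apply v (measurableSet_enterSet r a v)) hU .univ
  have hi (a v) : Integrable ((rect (net := net) a {y | y v ∈ enterSet r a v} U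
      Set.univ).indicator (1 : net.SlotNoise → ℝ)) := (integrable_const _).indicator (hm a v)
  simp_rw [h]
  rw [integral_finsetSum _ fun a _ => integrable_finsetSum _ fun v _ => hi a v, arrivalRate,
    mul_sum]
  refine sum_congr rfl fun a _ => ?_
  rw [integral_finsetSum _ fun v _ => hi a v, mul_sum, mul_sum]
  refine sum_congr rfl fun v _ => ?_
  rw [integral_indicator_one (hm a v), volume_rect, volume_eval_enterSet, probReal_univ]
  ring

theorem setIntegral_departures {U : Set I} (hU : MeasurableSet U) :
    ∫ x : net.SlotNoise,
        {x : net.SlotNoise | x.2.2.1 ∈ U}.indicator (fun x => (departures true x : ℝ)) x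
      = volume.real U * net.B := by
  have h (x : net.SlotNoise) :
      {x : net.SlotNoise | x.2.2.1 ∈ U}.indicator (fun x => (departures true x : ℝ)) x =
        ∑ a, (rect a Set.univ U (Set.Iio (net.Prdf
          #{w | a w = some Strategy.fm} #{w | a w = some Strategy.b}))).indicator
            (1 : net.SlotNoise → ℝ) x := by
    classical
    by_cases hx : x.2.2.1 ∈ U <;>
      simp [Set.indicator_apply, departures_eq_sum, mem_rect, hx]
  have hm (a) : MeasurableSet (rect (net := net) a Set.univ U (Set.Iio (net.Prdf
      #{w | a w = some Strategy.fm} #{w | a w = some Strategy.b}))) :=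
    measurableSet_rect a .univ hU measurableSet_Iio
  simp_rw [h]
  rw [integral_finsetSum _ fun a _ => (integrable_const _).indicator (hm a), B_eq_sum, mul_sum]
  refine sum_congr rfl fun a _ => ?_
  rw [integral_indicator_one (hm a), volume_rect, volume_real_Iio, probReal_univ]
  ring

variable {net} in
theorem step_eq (qr : I) (n : ℕ) (x : net.SlotNoise) : step qr n x =
    if n ≠ 0 ∧ x.2.2.1 < qr then n - departures true x + arrivals true x
    else n + arrivals false x := by
  have h0 : departures false x = 0 := by simp [departures]
  unfold step relayTransmits
  split_ifs with h <;> simp [h, h0]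

variable {net} in
theorem measurable_step (qr : I) (n : ℕ) : Measurable (step (net := net) qr n) := by
  rw [funext (step_eq qr n)]
  refine Measurable.ite ?_ ((measurable_const.sub measurable_departures).add
    (measurable_arrivals true)) (measurable_const.add (measurable_arrivals false))
  exact (MeasurableSet.const _).inter
    (measurable_snd.snd.fst measurableSet_Iio : MeasurableSet {x : net.SlotNoise | x.2.2.1 < qr})

variable {net} in
theorem step_le (qr : I) (n : ℕ) (x : net.SlotNoise) : step qr n x ≤ n + net.N := by
  have h := arrivals_le (relayTransmits qr n x) x
  unfold step
  omega

/-- The drift of the queue is `λ_r^1 - μ_r` as long as it is not empty. -/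
theorem integral_step (qr : I) {n : ℕ} (hn : n ≠ 0) :
    ∫ x : net.SlotNoise, (step qr n x : ℝ) = n + (net.lambda1 qr - net.mu qr) := by
  have hbound (U : Set I) (hU : MeasurableSet U) (g : net.SlotNoise → ℕ) (hg : Measurable g) (C : ℕ)
      (hC : ∀ x, g x ≤ C) :
      Integrable ({x : net.SlotNoise | x.2.2.1 ∈ U}.indicator fun x => (g x : ℝ)) := by
    refine Integrable.indicator ?_ (measurable_snd.snd.fst hU)
    exact .of_bound (measurable_from_nat.comp hg).aestronglyMeasurable C
      (.of_forall fun x => by simpa using hC x)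
  have h (x : net.SlotNoise) : (step qr n x : ℝ) = n +
      {x : net.SlotNoise | x.2.2.1 ∈ Set.Iio qr}.indicator (fun x => (arrivals true x : ℝ)) x +
      {x : net.SlotNoise | x.2.2.1 ∈ Set.Ici qr}.indicator (fun x => (arrivals false x : ℝ)) x -
      {x : net.SlotNoise | x.2.2.1 ∈ Set.Iio qr}.indicator
        (fun x => (departures true x : ℝ)) x := by
    have hd : departures true x ≤ n :=
      (show departures true x ≤ 1 by unfold departures; split_ifs <;> simp).trans
        (Nat.one_le_iff_ne_zero.2 hn)
    rw [step_eq]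
    by_cases hx : x.2.2.1 < qr
    · simp [hx, hn, Nat.cast_sub hd]
      ring
    · simp [hx, not_lt.1 hx]
  have i1 := hbound (Set.Iio qr) measurableSet_Iio _ (measurable_arrivals true) _ (arrivals_le true)
  have i2 := hbound (Set.Ici qr) measurableSet_Ici _ (measurable_arrivals false) _
    (arrivals_le false)
  have i3 := hbound (Set.Iio qr) measurableSet_Iio _ measurable_departures 1
    fun x => by unfold departures; split_ifs <;> simp
  have i01 := (integrable_const (n : ℝ)).add i1
  have i012 := i01.add i2
  simp_rw [h]
  refine (integral_sub i012 i3).trans ?_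
  rw [integral_add' i01 i2, integral_add' (integrable_const (n : ℝ)) i1, integral_const,
    setIntegral_arrivals _ _ measurableSet_Iio, setIntegral_arrivals _ _ measurableSet_Ici,
    setIntegral_departures _ measurableSet_Iio, volume_real_Iio, volume_real_Ici, probReal_univ,
    lambda1, mu, lambda0_eq, A_eq]
  simp only [smul_eq_mul]
  ring

/-! ### The queue until it is empty -/

variable {net} in
/-- The queue length at time `t + 1`, kept at `0` from the first time `≥ 1` at which the queue is
empty. -/
def excursion (qr : I) (n : ℕ) (ω : ℕ → net.SlotNoise) : ℕ → ℕ
  | 0 => step qr n (ω 0)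
  | t + 1 => if excursion qr n ω t = 0 then 0 else step qr (excursion qr n ω t) (ω (t + 1))

variable {net} in
theorem excursion_eq_queue (qr : I) (n : ℕ) (ω : ℕ → net.SlotNoise) :
    ∀ t, excursion qr n ω t ≠ 0 → excursion qr n ω t = queue qr n ω (t + 1)
  | 0, _ => rfl
  | t + 1, h => by
    have h0 : excursion qr n ω t ≠ 0 := fun h0 => h (by rw [excursion, if_pos h0])
    rw [excursion, if_neg h0, queue, ← excursion_eq_queue qr n ω t h0]

variable {net} in
theorem excursion_eq_zero_of_le {qr : I} {n : ℕ} {ω : ℕ → net.SlotNoise} {s t : ℕ}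
    (h : excursion qr n ω s = 0) (hst : s ≤ t) : excursion qr n ω t = 0 := by
  induction t, hst using Nat.le_induction with
  | base => exact h
  | succ t _ ih => rw [excursion, if_pos ih]

variable {net} in
theorem returnTime_eq_tsum (qr : I) (n : ℕ) (ω : ℕ → net.SlotNoise) :
    returnTime qr n ω =
      1 + ∑' t, {t | excursion qr n ω t ≠ 0}.indicator (fun _ => (1 : ℝ≥0∞)) t := by
  classical
  refine le_antisymm ?_ (le_iInf₂ fun t ht => ?_)
  · by_cases h : ∃ t, excursion qr n ω t = 0
    · have h0 := Nat.find_spec h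
      have hlt (s : ℕ) (hs : s < Nat.find h) : excursion qr n ω s ≠ 0 := Nat.find_min h hs
      set t := Nat.find h
      have hq : queue qr n ω (t + 1) = 0 := by
        rcases t with _ | t
        · exact h0
        · have hne := hlt t t.lt_succ_self
          rwa [excursion, if_neg hne, excursion_eq_queue qr n ω t hne] at h0
      refine (iInf₂_le (t + 1) ⟨by omega, hq⟩).trans ?_
      rw [Nat.cast_add, Nat.cast_one, add_comm]
      gcongr
      refine le_trans (le_of_eq ?_) (ENNReal.sum_le_tsum (range t))
      rw [sum_congr rfl fun s hs => Set.indicator_of_mem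
        (show s ∈ {t | excursion qr n ω t ≠ 0} from hlt s (mem_range.1 hs)) _]
      simp
    · push Not at h
      have : {t | excursion qr n ω t ≠ 0} = Set.univ := Set.eq_univ_of_forall h
      simp [this]
  · obtain ⟨ht1, hq⟩ := ht
    obtain ⟨t, rfl⟩ := Nat.exists_eq_succ_of_ne_zero (Nat.one_le_iff_ne_zero.1 ht1)
    have hz : excursion qr n ω t = 0 := by
      by_contra hne
      exact hne ((excursion_eq_queue qr n ω t hne).trans hq)
    rw [tsum_eq_sum (s := range t) fun s hs => Set.indicator_of_notMem
      (fun h : excursion qr n ω s ≠ 0 =>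
        h (excursion_eq_zero_of_le hz (not_lt.1 fun hlt => hs (mem_range.2 hlt)))) _]
    rw [Nat.succ_eq_add_one, Nat.cast_add, Nat.cast_one, add_comm]
    gcongr
    calc _ ≤ ∑ _s ∈ range t, (1 : ℝ≥0∞) :=
          sum_le_sum fun s _ => Set.indicator_le_self' (by simp) s
      _ = t := by simp

variable {net} in
/-- One slot of the excursion, as a function of its current value and of the noise. -/
def excursionStep (qr : I) (p : ℕ × net.SlotNoise) : ℕ := if p.1 = 0 then 0 else step qr p.1 p.2

variable {net} in
theorem measurable_excursionStep (qr : I) : Measurable (excursionStep (net := net) qr) :=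
  measurable_from_prod_countable_right fun k => by
    unfold excursionStep
    exact Measurable.ite (MeasurableSet.const (k = 0)) measurable_const (measurable_step qr k)

variable {net} in
theorem measurable_excursion (qr : I) (n t : ℕ) :
    Measurable fun ω : ℕ → net.SlotNoise => excursion qr n ω t := by
  induction t with
  | zero => exact (measurable_step qr n).comp (measurable_pi_apply 0)
  | succ t ih => exact (measurable_excursionStep qr).comp (ih.prodMk (measurable_pi_apply (t + 1)))

variable {net} in
theorem measurableSet_excursion_ne_zero (qr : I) (n t : ℕ) :
    MeasurableSet {ω : ℕ → net.SlotNoise | excursion qr n ω t ≠ 0} :=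
  measurable_excursion qr n t (.of_discrete (s := {k | k ≠ 0}))

variable {net} in
theorem excursion_congr (qr : I) (n : ℕ) {ω ω' : ℕ → net.SlotNoise} {t : ℕ}
    (h : ∀ s ≤ t, ω s = ω' s) : excursion qr n ω t = excursion qr n ω' t := by
  induction t with
  | zero => simp only [excursion, h 0 le_rfl]
  | succ t ih => simp only [excursion, ih fun s hs => h s (by omega), h (t + 1) le_rfl]

variable {net} in
theorem excursion_le (qr : I) (n : ℕ) (ω : ℕ → net.SlotNoise) (t : ℕ) :
    excursion qr n ω t ≤ n + (t + 1) * net.N := by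
  induction t with
  | zero => simpa [excursion] using step_le qr n (ω 0)
  | succ t ih =>
    rw [excursion]
    split_ifs
    · exact Nat.zero_le _
    · have := step_le qr (excursion qr n ω t) (ω (t + 1))
      linarith

instance : IsProbabilityMeasure net.law := by unfold law; infer_instance

theorem integrable_excursion (qr : I) (n t : ℕ) :
    Integrable (fun ω => (excursion qr n ω t : ℝ)) net.law :=
  .of_bound (measurable_from_nat.comp (measurable_excursion qr n t)).aestronglyMeasurable
    ((n + (t + 1) * net.N : ℕ) : ℝ) (.of_forall fun ω => by
      rw [Real.norm_natCast]; exact_mod_cast excursion_le qr n ω t)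

theorem law_map_eval (t : ℕ) : net.law.map (fun ω => ω t) = volume :=
  Measure.infinitePi_map_eval _ t

/-- The noise of the next slot is independent of the excursion up to now. -/
theorem indepFun_excursion (qr : I) (n t : ℕ) :
    ProbabilityTheory.IndepFun (fun ω : ℕ → net.SlotNoise => excursion qr n ω t)
      (fun ω => ω (t + 1)) net.law := by
  have hi := (ProbabilityTheory.iIndepFun_infinitePi
    (P := fun _ : ℕ => (volume : Measure net.SlotNoise)) (X := fun _ x => x)
    fun _ => measurable_id).indepFun_finset (range (t + 1)) {t + 1}
    (by simp) fun i => measurable_pi_apply i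
  -- Extend a finite sequence of slots arbitrarily to express the excursion as a function of it.
  let ext : (range (t + 1) → net.SlotNoise) → ℕ → net.SlotNoise :=
    fun z s => if h : s ∈ range (t + 1) then z ⟨s, h⟩ else 0
  have hext : Measurable ext := measurable_pi_lambda _ fun s => by
    by_cases h : s ∈ range (t + 1)
    · simpa only [ext, dif_pos h] using measurable_pi_apply _
    · simpa only [ext, dif_neg h] using measurable_const
  have := hi.comp ((measurable_excursion qr n t).comp hext)
    (measurable_pi_apply (⟨t + 1, mem_singleton_self _⟩ : ({t + 1} : Finset ℕ)))
  have hX : (fun ω : ℕ → net.SlotNoise => excursion qr n ω t) =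
      ((fun ω => excursion qr n ω t) ∘ ext) ∘ fun ω (i : range (t + 1)) => ω i := by
    funext ω
    refine excursion_congr qr n fun s hs => ?_
    simp [ext, Nat.not_lt.2 hs]
  rw [hX]
  exact this

theorem integral_excursion_zero (qr : I) {n : ℕ} (hn : n ≠ 0) :
    ∫ ω, (excursion qr n ω 0 : ℝ) ∂net.law = n + (net.lambda1 qr - net.mu qr) := by
  rw [← net.integral_step qr hn, ← net.law_map_eval 0,
    integral_map (measurable_pi_apply 0).aemeasurable]
  · rfl
  · exact (measurable_from_nat.comp (measurable_step qr n)).aestronglyMeasurable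

/-- While the excursion is positive its mean changes by the drift; at `0` it stays. -/
theorem integral_excursion_succ (qr : I) (n t : ℕ) :
    ∫ ω, (excursion qr n ω (t + 1) : ℝ) ∂net.law = ∫ ω, (excursion qr n ω t : ℝ) ∂net.law +
      (net.lambda1 qr - net.mu qr) * net.law.real {ω | excursion qr n ω t ≠ 0} := by
  set X := fun ω : ℕ → net.SlotNoise => excursion qr n ω t
  have hXm : Measurable X := measurable_excursion qr n t
  have hpair : Measurable fun ω : ℕ → net.SlotNoise => (X ω, ω (t + 1)) :=
    hXm.prodMk (measurable_pi_apply (t + 1))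
  have hF : Measurable fun p : ℕ × net.SlotNoise => (excursionStep qr p : ℝ) :=
    measurable_from_nat.comp (measurable_excursionStep qr)
  have hmap : net.law.map (fun ω => (X ω, ω (t + 1))) = (net.law.map X).prod volume := by
    rw [(net.indepFun_excursion qr n t).map_prod_eq_prod_map_map hXm.aemeasurable
      (measurable_pi_apply (t + 1)).aemeasurable, law_map_eval]
  have hint : Integrable (fun p : ℕ × net.SlotNoise => (excursionStep qr p : ℝ))
      ((net.law.map X).prod volume) := by
    rw [← hmap, integrable_map_measure hF.aestronglyMeasurable hpair.aemeasurable]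
    exact net.integrable_excursion qr n (t + 1)
  have hinner (k : ℕ) : ∫ x : net.SlotNoise, (excursionStep qr (k, x) : ℝ) =
      k + (net.lambda1 qr - net.mu qr) * {k : ℕ | k ≠ 0}.indicator 1 k := by
    by_cases hk : k = 0
    · simp [excursionStep, hk]
    · simp [excursionStep, hk, net.integral_step qr hk]
  have hprob : IsProbabilityMeasure (net.law.map X) :=
    Measure.isProbabilityMeasure_map hXm.aemeasurable
  calc ∫ ω, (excursion qr n ω (t + 1) : ℝ) ∂net.law
      = ∫ p : ℕ × net.SlotNoise, (excursionStep qr p : ℝ) ∂(net.law.map X).prod volume := by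
        rw [← hmap, integral_map hpair.aemeasurable hF.aestronglyMeasurable]
        rfl
    _ = ∫ k, (k + (net.lambda1 qr - net.mu qr) * {k : ℕ | k ≠ 0}.indicator 1 k)
          ∂net.law.map X := by
        rw [integral_prod _ hint]
        simp_rw [hinner]
    _ = ∫ ω, ((X ω : ℝ) + (net.lambda1 qr - net.mu qr) *
          {ω | X ω ≠ 0}.indicator (1 : (ℕ → net.SlotNoise) → ℝ) ω) ∂net.law := by
        rw [integral_map hXm.aemeasurable measurable_from_nat.aestronglyMeasurable]
        rfl
    _ = _ := by
        have hm := measurableSet_excursion_ne_zero (net := net) qr n t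
        refine (integral_add (net.integrable_excursion qr n t)
          (((integrable_const (1 : ℝ)).indicator hm).const_mul _)).trans ?_
        rw [integral_const_mul]
        exact congrArg (_ + _ * ·) (integral_indicator_one hm)

/-- Summing up the drift. As the excursion is nonnegative, this bounds the sum of the probabilities
that it goes on when the drift is negative. -/
theorem integral_excursion (qr : I) (n t : ℕ) :
    ∫ ω, (excursion qr n ω t : ℝ) ∂net.law = ∫ ω, (excursion qr n ω 0 : ℝ) ∂net.law +
      (net.lambda1 qr - net.mu qr) *
        ∑ s ∈ range t, net.law.real {ω | excursion qr n ω s ≠ 0} := by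
  induction t with
  | zero => simp
  | succ t ih => rw [integral_excursion_succ, ih, sum_range_succ]; ring

theorem lintegral_returnTime (qr : I) (n : ℕ) :
    ∫⁻ ω, returnTime qr n ω ∂net.law = 1 + ∑' t, net.law {ω | excursion qr n ω t ≠ 0} := by
  have h (ω : ℕ → net.SlotNoise) (t : ℕ) :
      {t | excursion qr n ω t ≠ 0}.indicator (fun _ => (1 : ℝ≥0∞)) t =
        {ω | excursion qr n ω t ≠ 0}.indicator 1 ω := rfl
  have hm := measurableSet_excursion_ne_zero (net := net) qr n
  simp_rw [returnTime_eq_tsum, h]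
  rw [lintegral_add_left measurable_const, lintegral_const, measure_univ, mul_one,
    lintegral_tsum fun t => (measurable_one.indicator (hm t)).aemeasurable]
  simp_rw [lintegral_indicator_one (hm _)]

/-! ### The stability condition -/

theorem stable_of_lt {qr : I} (h : net.lambda1 qr < net.mu qr) : net.Stable qr := by
  intro n
  rw [lintegral_returnTime]
  refine ENNReal.add_lt_top.2 ⟨ENNReal.one_lt_top, lt_of_le_of_lt (ENNReal.tsum_le_of_sum_range_le
    (c := ENNReal.ofReal ((∫ ω, (excursion qr n ω 0 : ℝ) ∂net.law) / (net.mu qr - net.lambda1 qr)))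
    fun T => ?_) ENNReal.ofReal_lt_top⟩
  have h0 : 0 ≤ ∫ ω, (excursion qr n ω T : ℝ) ∂net.law := integral_nonneg fun _ => Nat.cast_nonneg _
  rw [integral_excursion] at h0
  have hsum : ∑ t ∈ range T, net.law {ω | excursion qr n ω t ≠ 0} =
      ENNReal.ofReal (∑ t ∈ range T, net.law.real {ω | excursion qr n ω t ≠ 0}) := by
    rw [ENNReal.ofReal_sum_of_nonneg fun _ _ => measureReal_nonneg]
    exact sum_congr rfl fun _ _ => (ofReal_measureReal).symm
  rw [hsum]
  refine ENNReal.ofReal_le_ofReal ((le_div_iff₀ (by linarith)).2 ?_)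
  linarith

/-- Without negative drift, an excursion from length `1` has mean at least `1` at all times; as it
grows at most linearly, the probability that it goes on is at least of order `1/t`, which is not
summable. -/
theorem not_stable_of_le {qr : I} (h : net.mu qr ≤ net.lambda1 qr) : ¬ net.Stable qr := by
  intro hs
  have hlt := hs 1
  rw [lintegral_returnTime] at hlt
  have hsum : Summable fun t => net.law.real {ω | excursion qr 1 ω t ≠ 0} :=
    ENNReal.summable_toReal (ENNReal.add_lt_top.1 hlt).2.ne
  have hmean (t : ℕ) : 1 ≤ ∫ ω, (excursion qr 1 ω t : ℝ) ∂net.law := by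
    rw [integral_excursion, integral_excursion_zero _ _ one_ne_zero]
    have := mul_nonneg (sub_nonneg.2 h) (sum_nonneg (s := range t) fun s _ =>
      measureReal_nonneg (μ := net.law) (s := {ω | excursion qr 1 ω s ≠ 0}))
    push_cast
    linarith
  have hle (t : ℕ) : ∫ ω, (excursion qr 1 ω t : ℝ) ∂net.law ≤
      (net.N + 1) * (t + 1) * net.law.real {ω | excursion qr 1 ω t ≠ 0} := by
    have hm := measurableSet_excursion_ne_zero (net := net) qr 1 t
    rw [← integral_indicator_one hm, ← integral_const_mul]
    refine integral_mono (net.integrable_excursion qr 1 t)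
      (((integrable_const (1 : ℝ)).indicator hm).const_mul _) fun ω => ?_
    by_cases h0 : excursion qr 1 ω t = 0
    · simp [h0]
    · have := excursion_le qr 1 ω t
      have h2 : excursion qr 1 ω t ≤ (net.N + 1) * (t + 1) := by nlinarith
      simpa [h0] using mod_cast h2
  refine Real.not_summable_one_div_natCast ((summable_nat_add_iff 1).1 ?_)
  refine Summable.of_nonneg_of_le (fun t => by positivity) (fun t => ?_)
    (hsum.mul_left ((net.N : ℝ) + 1))
  rw [div_le_iff₀ (by positivity)]
  push_cast
  linarith [hmean t, hle t]

theorem stable_iff (qr : I) : net.Stable qr ↔ net.lambda1 qr < net.mu qr :=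
  ⟨fun h => not_le.1 fun hle => net.not_stable_of_le hle h, net.stable_of_lt⟩

theorem lambda0_nonneg : 0 ≤ net.lambda0 := by
  have := net.setIntegral_arrivals false MeasurableSet.univ
  rw [probReal_univ, one_mul, ← lambda0_eq] at this
  rw [← this]
  exact integral_nonneg fun x => Set.indicator_nonneg (fun _ _ => Nat.cast_nonneg _) x

theorem lambda1_lt_mu_iff (qr : I) :
    net.lambda1 qr < net.mu qr ↔ net.lambda0 < qr * (net.lambda0 + net.B - net.A) := by
  rw [lambda1, mu, ← sub_pos, ← sub_pos (b := net.lambda0)]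
  ring_nf

end

end RelayNetwork

theorem mainTheorem2 (net : RelayNetwork) (qr : unitInterval) :
    (net.Stable qr ↔ net.lambda1 qr < net.mu qr) ∧
    (0 < net.lambda0 + net.B - net.A →
      (net.Stable qr ↔ net.qrmin < (qr : ℝ) ∧ (qr : ℝ) ≤ 1)) ∧
    (net.lambda0 + net.B - net.A ≤ 0 → ¬ net.Stable qr) ∧
    (net.N = 2 →
      net.lambda0 = net.arrivalTwo false ∧ net.A = net.arrivalTwo true ∧
        net.B = net.serviceTwo) := by
  refine ⟨net.stable_iff qr, fun hD => ?_, fun hD => ?_, fun hN => ⟨?_, ?_, ?_⟩⟩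
  · rw [net.stable_iff, net.lambda1_lt_mu_iff, RelayNetwork.qrmin, div_lt_iff₀ hD]
    exact (and_iff_left qr.2.2).symm
  · rw [net.stable_iff, net.lambda1_lt_mu_iff, not_lt]
    exact (mul_nonpos_of_nonneg_of_nonpos qr.2.1 hD).trans net.lambda0_nonneg
  · rw [net.lambda0_eq, net.arrivalRate_two false hN]
  · rw [net.A_eq, net.arrivalRate_two true hN]
  · exact net.B_eq_serviceTwo hN
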